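/- Let $M$ be a finite-dimensional smooth manifold (without boundary) and let $\alpha\in\Omega^1(M)$ be a smooth $1$-form. Let $G$ be a finite-dimensional Lie group with Lie algebra $\mathfrak g=T_1G$, acting smoothly on $M$ from the left (for instance, a finite-dimensional Lie subgroup $G\subseteq\mathrm{Diff}(M)$ acting smoothly on $M$), and suppose that $\psi^*\alpha=\alpha$ for all $\psi\in G$. For $X\in\mathfrak g$ and $q\in M$ let $X_q=\frac{d}{dt}\big|_{t=0}\exp(tX)\cdot q\in T_qM$ be the infinitesimal generator of the action. Let $\pi:T^*M\to M$ be the projection and $\lambda_{\mathrm{can}}$ the Liouville $1$-form, $(\lambda_{\mathrm{can}})_{(q,p)}(\xi)=p(d\pi\,\xi)$, and endow $T^*M$ with the twisted form $$\omega=d\lambda_{\mathrm{can}}-\pi^*d\alpha .$$ Then $\omega$ is a symplectic form, and the natural action $$\psi\cdot(q,p)=\big(\psi(q),\,p\circ(d\psi_q)^{-1}\big)$$ of $G$ on $(T^*M,\omega)$ is Hamiltonian, with moment map $$\mu:T^*M\to\mathfrak g^*,\qquad \mu(q,p)(X)=p(X_q)-\alpha_q(X_q).$$ That is: this is a smooth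 left action by symplectomorphisms of $\omega$; the map $\mu$ is smooth; for every $X\in\mathfrak g$, with $X^\#$ the infinitesimal generator of the action on $T^*M$, $$\iota_{X^\#}\omega=-\,d\langle\mu,X\rangle ;$$ and $\mu$ is equivariant, $\mu(\psi\cdot z)(X)=\mu(z)(\mathrm{Ad}_{\psi^{-1}}X)$ for all $\psi\in G$, $z\in T^*M$, $X\in\mathfrak g$. -/

import Mathlib

open scoped Manifold ContDiff Bundle

noncomputable section

namespace TwistedCotangent

/-! ### Differential forms on manifolds -/

section Forms

variable {E : Type*} [NormedAddCommGroup E] [NormedSpace ℝ E]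
  {H : Type*} [TopologicalSpace H] (I : ModelWithCorners ℝ E H)
  {M : Type*} [TopologicalSpace M] [ChartedSpace H M]
  {E' : Type*} [NormedAddCommGroup E'] [NormedSpace ℝ E']
  {H' : Type*} [TopologicalSpace H'] (I' : ModelWithCorners ℝ E' H')
  {M' : Type*} [TopologicalSpace M'] [ChartedSpace H' M']

variable (M) in
/-- Real-valued differential `k`-forms on `M`; smoothness is the separate predicate
`IsSmoothForm`. -/
abbrev DiffForm (k : ℕ) : Type _ :=
  (x : M) → TangentSpace I x [⋀^Fin k]→L[ℝ] ℝ

/-- The `1`-form given by a field of covectors. -/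
def oneForm (θ : (x : M) → TangentSpace I x →L[ℝ] ℝ) : DiffForm I M 1 :=
  fun x ↦ ContinuousAlternatingMap.ofSubsingleton ℝ (TangentSpace I x) ℝ (0 : Fin 1) (θ x)

/-- The pull-back `f^* Ω` of a differential form. -/
def formPullback {k : ℕ} (f : M → M') (Ω : DiffForm I' M' k) : DiffForm I M k :=
  fun x ↦ (Ω (f x)).compContinuousLinearMap (mfderiv I I' f x)

/-- The expression of `Ω` in the preferred chart around `x`: the pull-back of `Ω` under the inverse
of that chart, a differential form on (an open piece of) the model vector space. -/
def formInChart {k : ℕ} (Ω : DiffForm I M k) (x : M) (y : E) : E [⋀^Fin k]→L[ℝ] ℝ :=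
  (Ω ((extChartAt I x).symm y)).compContinuousLinearMap
    (mfderivWithin 𝓘(ℝ, E) I (extChartAt I x).symm (Set.range I) y)

/-- A differential form is smooth if its expression in every preferred chart is smooth. -/
def IsSmoothForm {k : ℕ} (Ω : DiffForm I M k) : Prop :=
  ∀ x : M, ContDiffOn ℝ ∞ (formInChart I Ω x) (extChartAt I x).target

/-- The exterior derivative of a differential form on a manifold: at `x`, the exterior derivative of
its expression in the preferred chart around `x`, pulled back by that chart. -/
def mextDeriv {k : ℕ} (Ω : DiffForm I M k) : DiffForm I M (k + 1) :=
  fun x ↦ (extDerivWithin (formInChart I Ω x) (Set.range I)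
    (extChartAt I x x)).compContinuousLinearMap (mfderiv I 𝓘(ℝ, E) (extChartAt I x) x)

/-- A symplectic form: a smooth, closed, nondegenerate `2`-form. -/
structure IsSymplecticForm (Ω : DiffForm I M 2) : Prop where
  smooth : IsSmoothForm I Ω
  closed : mextDeriv I Ω = 0
  nondegenerate : ∀ (x : M) (v : TangentSpace I x),
    (∀ w : TangentSpace I x, Ω x ![v, w] = 0) → v = 0

end Forms

/-! ### Hamiltonian actions -/

section Actions

variable {F : Type*} [NormedAddCommGroup F] [NormedSpace ℝ F]
  {K : Type*} [TopologicalSpace K] (J : ModelWithCorners ℝ F K)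
  {G : Type*} [TopologicalSpace G] [ChartedSpace K G] [Group G]
  {E : Type*} [NormedAddCommGroup E] [NormedSpace ℝ E]
  {H : Type*} [TopologicalSpace H] (I : ModelWithCorners ℝ E H)
  {N : Type*} [TopologicalSpace N] [ChartedSpace H N]

/-- The infinitesimal generator `X_z` at `z` of `X ∈ 𝔤 = T_1 G`, as a linear function of `X`: the
derivative at `1` of the orbit map `g ↦ a g z` (equivalently, the velocity at `t = 0` of
`exp(tX)·z`). It takes values in the tangent space at `a 1 z`, which is `z` for an action `a`. -/
def generator (a : G → N → N) (z : N) : GroupLieAlgebra J G →L[ℝ] TangentSpace I z :=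
  (mfderiv J I (fun g : G ↦ a g z) 1 : TangentSpace J (1 : G) →L[ℝ] TangentSpace I (a 1 z))

/-- The adjoint action of `g` on the Lie algebra: the derivative at `1` of `h ↦ g h g⁻¹`. It takes
values in the tangent space at `g 1 g⁻¹`, which is `1`. -/
def Ad (g : G) : GroupLieAlgebra J G →L[ℝ] GroupLieAlgebra J G :=
  (mfderiv J J (fun h : G ↦ g * h * g⁻¹) 1 :
    TangentSpace J (1 : G) →L[ℝ] TangentSpace J (g * 1 * g⁻¹))

/-- `a` is a smooth left action of the Lie group `G` on the manifold `N` which is Hamiltonian with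
respect to the symplectic form `Ω`, with moment map `μ : N → 𝔤^*`. The sign convention is
`ι_{X^#} Ω = - d ⟨μ, X⟩`. -/
structure IsHamiltonianAction (Ω : DiffForm I N 2) (a : G → N → N)
    (μ : N → (GroupLieAlgebra J G →L[ℝ] ℝ)) : Prop where
  isSymplectic : IsSymplecticForm I Ω
  one_act : ∀ z, a 1 z = z
  mul_act : ∀ g h z, a (g * h) z = a g (a h z)
  smooth_act : ContMDiff (J.prod I) I ∞ (fun x : G × N ↦ a x.1 x.2)
  /-- the action is by symplectomorphisms -/
  pullback_act : ∀ g, formPullback I I (a g) Ω = Ω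
  /-- `μ` is smooth: each of its components is -/
  smooth_moment : ∀ X, ContMDiff I 𝓘(ℝ, ℝ) ∞ (fun z ↦ μ z X)
  /-- `⟨μ, X⟩` is a Hamiltonian function for the infinitesimal generator of `X` -/
  hamiltonian : ∀ (X : GroupLieAlgebra J G) (z : N) (v : TangentSpace I z),
    Ω z ![generator J I a z X, v] = -(mfderiv I 𝓘(ℝ, ℝ) (fun y ↦ μ y X) z v : ℝ)
  /-- `μ` is equivariant for the coadjoint action: `μ (g · z) = μ z ∘ Ad_{g⁻¹}` -/
  equivariant : ∀ g z X, μ (a g z) X = μ z (Ad J g⁻¹ X)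

end Actions

/-! ### The cotangent bundle with its twisted symplectic form -/

section Cotangent

variable {E : Type*} [NormedAddCommGroup E] [NormedSpace ℝ E]
  {M : Type*} [TopologicalSpace M] [ChartedSpace E M] [IsManifold 𝓘(ℝ, E) ∞ M]

variable (E M) in
/-- The cotangent bundle `T^*M`, with Mathlib's topology and charts on the bundle of continuous
linear maps from the tangent bundle to the trivial line bundle. -/
abbrev CotangentBundle : Type _ :=
  Bundle.TotalSpace (E →L[ℝ] ℝ)
    (fun q : M ↦ TangentSpace 𝓘(ℝ, E) q →L[ℝ] Bundle.Trivial M ℝ q)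

variable (E) in
/-- The model of the cotangent bundle. -/
abbrev cotangentModel : ModelWithCorners ℝ (E × (E →L[ℝ] ℝ)) (ModelProd E (E →L[ℝ] ℝ)) :=
  𝓘(ℝ, E).prod 𝓘(ℝ, E →L[ℝ] ℝ)

variable (E M) in
/-- The projection `π : T^*M → M`. -/
def cotangentProj (z : CotangentBundle E M) : M := z.1

variable (E M) in
/-- The Liouville form: `λ_can` at `(q, p)` is `ξ ↦ p (dπ ξ)`. -/
def liouville (z : CotangentBundle E M) : TangentSpace (cotangentModel E) z →L[ℝ] ℝ :=
  (z.2 : TangentSpace 𝓘(ℝ, E) z.1 →L[ℝ] ℝ).comp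
    (mfderiv (cotangentModel E) 𝓘(ℝ, E) (cotangentProj E M) z)

/-- The twisted form `dλ_can - π^* dα` on `T^*M`. -/
def twistedForm (α : (q : M) → TangentSpace 𝓘(ℝ, E) q →L[ℝ] ℝ) :
    DiffForm (cotangentModel E) (CotangentBundle E M) 2 :=
  mextDeriv (cotangentModel E) (oneForm (cotangentModel E) (liouville E M)) -
    formPullback (cotangentModel E) 𝓘(ℝ, E) (cotangentProj E M)
      (mextDeriv 𝓘(ℝ, E) (oneForm 𝓘(ℝ, E) α))

/-- The natural lift of an action on `M` to `T^*M`: `ψ · (q, p) = (ψ q, p ∘ (dψ_q)⁻¹)`. -/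
def cotangentLift {G : Type*} [Group G] [MulAction G M] (g : G) (z : CotangentBundle E M) :
    CotangentBundle E M :=
  ⟨g • z.1, (z.2 : TangentSpace 𝓘(ℝ, E) z.1 →L[ℝ] ℝ).comp
    (mfderiv 𝓘(ℝ, E) 𝓘(ℝ, E) (fun q : M ↦ g • q) z.1).inverse⟩

/-- The map `μ(q, p) = [X ↦ p (X_q) - α_q (X_q)]` from `T^*M` to `𝔤^*`. -/
def cotangentMoment {F : Type*} [NormedAddCommGroup F] [NormedSpace ℝ F]
    {G : Type*} [TopologicalSpace G] [ChartedSpace F G] [Group G] [MulAction G M]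
    (α : (q : M) → TangentSpace 𝓘(ℝ, E) q →L[ℝ] ℝ) (z : CotangentBundle E M) :
    GroupLieAlgebra 𝓘(ℝ, F) G →L[ℝ] ℝ :=
  ((z.2 : TangentSpace 𝓘(ℝ, E) z.1 →L[ℝ] ℝ) - α z.1).comp
    (generator 𝓘(ℝ, F) 𝓘(ℝ, E) (fun (g : G) (q : M) ↦ g • q) z.1)

end Cotangent

end TwistedCotangent

end

/-! The twisted form is exact: `ω = dθ` with `θ = λ_can - π^* α` (`twistedPotential`,
`twistedForm_eq_mextDeriv`). Everything follows from the invariance of `θ` under the lifted action: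
`λ_can` is preserved by every cotangent lift, and `π^* α` because `α` is invariant and `π`
intertwines the two actions (`formPullback_cotangentLift_twistedPotential`). Naturality of `d`
(`formPullback_mextDeriv`) then gives invariance of `ω`.

Cartan's formula turns `L_{X^#} θ = 0` into `ι_{X^#} dθ = -d(θ(X^#))` (`mextDeriv_generator_apply`).
Since `X^#` projects to the generator on `M`, the function `θ(X^#)` is `p(X_q) - α_q(X_q)`, which is
the moment map (`twistedPotential_generator`). Equivariance comes from `X_{gq} = dg (Ad_{g⁻¹} X)_q`
(`generator_smul`).

Closedness is `d² = 0`. Nondegeneracy holds because `dλ_can` is standard in canonical coordinates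
and the twist involves only base components (`twistedForm_apply`).

As `mextDeriv` uses a different chart at each point, the analytic foundation is
`formPullback_mextDeriv_vectorSpace`: naturality for maps out of a vector space, which contains
independence of the chart. -/

open scoped Topology

namespace TwistedCotangent

/-! ### Exterior derivative in charts: chart independence and `d² = 0`. -/

section Forms

variable {E : Type*} [NormedAddCommGroup E] [NormedSpace ℝ E]
  {H : Type*} [TopologicalSpace H] {I : ModelWithCorners ℝ E H}
  {M : Type*} [TopologicalSpace M] [ChartedSpace H M]
  {V : Type*} [NormedAddCommGroup V] [NormedSpace ℝ V]

theorem minSmoothness_two_le_infty : minSmoothness ℝ 2 ≤ (∞ : WithTop ℕ∞) := by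
  rw [minSmoothness_of_isRCLikeNormedField]
  exact WithTop.coe_le_coe.2 (le_top : (2 : ℕ∞) ≤ ⊤)

theorem contDiffAt_extChartAt_comp [IsManifold I ∞ M] {f : V → M} {v₀ : V}
    (hf : ContMDiffAt 𝓘(ℝ, V) I ∞ f v₀) :
    ContDiffAt ℝ ∞ (extChartAt I (f v₀) ∘ f) v₀ :=
  ((contMDiffAt_extChartAt (x := f v₀)).comp v₀ hf).contDiffAt

variable [I.Boundaryless]

theorem formInChart_eq_formPullback {k : ℕ} (Ω : DiffForm I M k) (x : M) :
    formInChart I Ω x = formPullback 𝓘(ℝ, E) I (extChartAt I x).symm Ω := by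
  ext1 y
  simp only [formInChart, formPullback, I.range_eq_univ, mfderivWithin_univ]
  rfl

theorem IsSmoothForm.contDiffAt {k : ℕ} {Ω : DiffForm I M k} (hΩ : IsSmoothForm I Ω) (x : M)
    {y : E} (hy : y ∈ (extChartAt I x).target) : ContDiffAt ℝ ∞ (formInChart I Ω x) y :=
  (hΩ x).contDiffAt ((isOpen_extChartAt_target x).mem_nhds hy)

variable [IsManifold I ∞ M]

theorem contMDiffAt_extChartAt_symm {x : M} {y : E} (hy : y ∈ (extChartAt I x).target) :
    ContMDiffAt 𝓘(ℝ, E) I ∞ (extChartAt I x).symm y :=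
  (contMDiffOn_extChartAt_symm x).contMDiffAt ((isOpen_extChartAt_target x).mem_nhds hy)

/-- Locally, the pull-back of a form under a map from a vector space factors through a chart. -/
theorem formPullback_eventuallyEq {k : ℕ} (Ω : DiffForm I M k) {f : V → M} {v₀ : V}
    (hf : ContMDiffAt 𝓘(ℝ, V) I ∞ f v₀) :
    (formPullback 𝓘(ℝ, V) I f Ω : V → V [⋀^Fin k]→L[ℝ] ℝ) =ᶠ[𝓝 v₀] fun v ↦
      (formInChart I Ω (f v₀) (extChartAt I (f v₀) (f v))).compContinuousLinearMap
        (fderiv ℝ (extChartAt I (f v₀) ∘ f) v) := by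
  have h1 : ∀ᶠ v in 𝓝 v₀, ContMDiffAt 𝓘(ℝ, V) I 1 f v :=
    (contMDiffAt_iff_contMDiffAt_nhds (by simp)).1 (hf.of_le (by simp))
  have h2 : ∀ᶠ v in 𝓝 v₀, ∀ᶠ w in 𝓝 v, f w ∈ (extChartAt I (f v₀)).source :=
    eventually_eventually_nhds.2 <|
      hf.continuousAt.eventually_mem (extChartAt_source_mem_nhds (f v₀))
  filter_upwards [h1, h2] with v hv1 hv2
  have hs := hv2.self_of_nhds
  have ht := (extChartAt I (f v₀)).map_source hs
  have hd : MDifferentiableAt 𝓘(ℝ, V) 𝓘(ℝ, E) (extChartAt I (f v₀) ∘ f) v :=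
    (mdifferentiableAt_extChartAt (by simpa using hs)).comp v (hv1.mdifferentiableAt one_ne_zero)
  have he : f =ᶠ[𝓝 v] (extChartAt I (f v₀)).symm ∘ (extChartAt I (f v₀) ∘ f) := by
    filter_upwards [hv2] with w hw
    exact ((extChartAt I (f v₀)).left_inv hw).symm
  have hm : mfderiv 𝓘(ℝ, V) I f v =
      (mfderiv 𝓘(ℝ, E) I (extChartAt I (f v₀)).symm (extChartAt I (f v₀) (f v))).comp
        (fderiv ℝ (extChartAt I (f v₀) ∘ f) v) := by
    rw [he.mfderiv_eq, mfderiv_comp v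
      ((contMDiffAt_extChartAt_symm ht).mdifferentiableAt (by simp)) hd, mfderiv_eq_fderiv]
    rfl
  have hl : (extChartAt I (f v₀)).symm (extChartAt I (f v₀) (f v)) = f v :=
    (extChartAt I (f v₀)).left_inv hs
  rw [formInChart_eq_formPullback]
  ext w
  simp only [formPullback, hm]
  rw [hl]
  rfl

/-- The exterior derivative on a manifold is natural for maps from a vector space. -/
theorem formPullback_mextDeriv_vectorSpace {k : ℕ} {Ω : DiffForm I M k} (hΩ : IsSmoothForm I Ω)
    {f : V → M} {v₀ : V} (hf : ContMDiffAt 𝓘(ℝ, V) I ∞ f v₀) :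
    (formPullback 𝓘(ℝ, V) I f (mextDeriv I Ω) v₀ : V [⋀^Fin (k + 1)]→L[ℝ] ℝ) =
      extDeriv (formPullback 𝓘(ℝ, V) I f Ω : V → V [⋀^Fin k]→L[ℝ] ℝ) v₀ := by
  -- Near `v₀` the pull-back goes through one fixed chart, so the vector-space naturality
  -- `extDeriv_pullback` applies.
  rw [(formPullback_eventuallyEq Ω hf).extDeriv_eq]
  have hp := extDeriv_pullback (f := extChartAt I (f v₀) ∘ f) (x := v₀)
    ((hΩ.contDiffAt _ (mem_extChartAt_target (f v₀))).differentiableAt (by simp))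
    (contDiffAt_extChartAt_comp hf) minSmoothness_two_le_infty
  simp only [Function.comp_apply] at hp ⊢
  refine Eq.trans ?_ hp.symm
  have hm : fderiv ℝ (extChartAt I (f v₀) ∘ f) v₀ =
      (mfderiv I 𝓘(ℝ, E) (extChartAt I (f v₀)) (f v₀)).comp (mfderiv 𝓘(ℝ, V) I f v₀) := by
    rw [← mfderiv_eq_fderiv, mfderiv_comp v₀ (mdifferentiableAt_extChartAt (by simp))
      (hf.mdifferentiableAt (by simp))]
  rw [hm]
  simp only [formPullback, mextDeriv, I.range_eq_univ, extDerivWithin_univ]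
  rfl

/-- Independence of the chart: the left side uses the preferred chart at each point, the right side
the single chart around `x`. It is naturality applied to the inverse chart. -/
theorem formInChart_mextDeriv {k : ℕ} {Ω : DiffForm I M k} (hΩ : IsSmoothForm I Ω) (x : M)
    {y : E} (hy : y ∈ (extChartAt I x).target) :
    formInChart I (mextDeriv I Ω) x y = extDeriv (formInChart I Ω x) y := by
  rw [formInChart_eq_formPullback, formInChart_eq_formPullback]
  exact formPullback_mextDeriv_vectorSpace hΩ (contMDiffAt_extChartAt_symm hy)

theorem isSmoothForm_mextDeriv {k : ℕ} {Ω : DiffForm I M k} (hΩ : IsSmoothForm I Ω) :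
    IsSmoothForm I (mextDeriv I Ω) := by
  intro x
  refine ContDiffOn.congr (f := extDeriv (formInChart I Ω x)) (fun y hy ↦ ?_)
    fun y hy ↦ formInChart_mextDeriv hΩ x hy
  have h := (hΩ.contDiffAt x hy).fderiv_right (m := ∞) (by simp)
  exact ((ContinuousAlternatingMap.alternatizeUncurryFinCLM ℝ E ℝ).contDiff.contDiffAt.comp y
    h).contDiffWithinAt

theorem mextDeriv_mextDeriv {k : ℕ} {Ω : DiffForm I M k} (hΩ : IsSmoothForm I Ω) :
    mextDeriv I (mextDeriv I Ω) = 0 := by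
  ext1 x
  have hx := mem_extChartAt_target (I := I) x
  -- The outer derivative needs equality of germs, not only of values at the centre.
  have he : formInChart I (mextDeriv I Ω) x =ᶠ[𝓝 (extChartAt I x x)]
      extDeriv (formInChart I Ω x) := by
    filter_upwards [(isOpen_extChartAt_target x).mem_nhds hx] with y hy
    exact formInChart_mextDeriv hΩ x hy
  simp only [mextDeriv, I.range_eq_univ, extDerivWithin_univ]
  rw [he.extDeriv_eq, extDeriv_extDeriv_apply (hΩ.contDiffAt x hx) minSmoothness_two_le_infty]
  rfl

end Forms

/-! ### Naturality of the exterior derivative and smoothness of pulled-back 1-forms. -/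

section Pullback

variable {E : Type*} [NormedAddCommGroup E] [NormedSpace ℝ E]
  {H : Type*} [TopologicalSpace H] {I : ModelWithCorners ℝ E H}
  {M : Type*} [TopologicalSpace M] [ChartedSpace H M]
  {E' : Type*} [NormedAddCommGroup E'] [NormedSpace ℝ E']
  {H' : Type*} [TopologicalSpace H'] {I' : ModelWithCorners ℝ E' H'}
  {M' : Type*} [TopologicalSpace M'] [ChartedSpace H' M']
  {E'' : Type*} [NormedAddCommGroup E''] [NormedSpace ℝ E'']
  {H'' : Type*} [TopologicalSpace H''] {I'' : ModelWithCorners ℝ E'' H''}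
  {M'' : Type*} [TopologicalSpace M''] [ChartedSpace H'' M'']

theorem formPullback_comp_apply {k : ℕ} (Ω : DiffForm I'' M'' k) {g : M' → M''} {f : M → M'} {x : M}
    (hg : MDifferentiableAt I' I'' g (f x)) (hf : MDifferentiableAt I I' f x) :
    formPullback I I'' (g ∘ f) Ω x =
      (formPullback I' I'' g Ω (f x)).compContinuousLinearMap (mfderiv I I' f x) := by
  simp only [formPullback, mfderiv_comp x hg hf]
  rfl

theorem formPullback_oneForm (f : M → M') (θ : (x : M') → TangentSpace I' x →L[ℝ] ℝ) :
    formPullback I I' f (oneForm I' θ) =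
      oneForm I (fun x ↦ (θ (f x)).comp (mfderiv I I' f x)) := rfl

theorem formInChart_sub {k : ℕ} (Ω₁ Ω₂ : DiffForm I M k) (x : M) :
    formInChart I (Ω₁ - Ω₂) x = formInChart I Ω₁ x - formInChart I Ω₂ x := rfl

theorem IsSmoothForm.sub {k : ℕ} {Ω₁ Ω₂ : DiffForm I M k} (h₁ : IsSmoothForm I Ω₁)
    (h₂ : IsSmoothForm I Ω₂) : IsSmoothForm I (Ω₁ - Ω₂) :=
  fun x ↦ (h₁ x).sub (h₂ x)

theorem _root_.ContDiffAt.compContinuousLinearMap_one {V : Type*} [NormedAddCommGroup V]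
    [NormedSpace ℝ V] {A : V → E [⋀^Fin 1]→L[ℝ] ℝ} {L : V → E' →L[ℝ] E} {v : V}
    {n : WithTop ℕ∞} (hA : ContDiffAt ℝ n A v) (hL : ContDiffAt ℝ n L v) :
    ContDiffAt ℝ n (fun w ↦ (A w).compContinuousLinearMap (L w)) v := by
  -- In degree one, alternating maps are linear maps up to a linear isometry, and pull-back becomes
  -- composition, which is bilinear.
  let Φ := ContinuousAlternatingMap.ofSubsingletonLIE (𝕜 := ℝ) (E := E) (F := ℝ) (0 : Fin 1)
  let Φ' := ContinuousAlternatingMap.ofSubsingletonLIE (𝕜 := ℝ) (E := E') (F := ℝ) (0 : Fin 1)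
  have h : ContDiffAt ℝ n (fun w ↦ Φ' ((Φ.symm (A w)).comp (L w))) v :=
    Φ'.contDiff.contDiffAt.comp v ((Φ.symm.contDiff.contDiffAt.comp v hA).clm_comp hL)
  refine h.congr_of_eventuallyEq (.of_forall fun w ↦ ?_)
  obtain ⟨B, hB⟩ := Φ.surjective (A w)
  simp only [← hB, Φ.symm_apply_apply]
  rfl

variable [I.Boundaryless]

theorem mextDeriv_sub {k : ℕ} {Ω₁ Ω₂ : DiffForm I M k} (h₁ : IsSmoothForm I Ω₁)
    (h₂ : IsSmoothForm I Ω₂) : mextDeriv I (Ω₁ - Ω₂) = mextDeriv I Ω₁ - mextDeriv I Ω₂ := by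
  ext1 x
  have hx := mem_extChartAt_target (I := I) x
  simp only [mextDeriv, I.range_eq_univ, extDerivWithin_univ, formInChart_sub, Pi.sub_apply]
  have hs : extDeriv (formInChart I Ω₁ x - formInChart I Ω₂ x) (extChartAt I x x) =
      extDeriv (formInChart I Ω₁ x) (extChartAt I x x) -
        extDeriv (formInChart I Ω₂ x) (extChartAt I x x) := by
    simp only [extDeriv]
    rw [fderiv_sub ((h₁.contDiffAt x hx).differentiableAt (by simp))
      ((h₂.contDiffAt x hx).differentiableAt (by simp))]
    exact map_sub (ContinuousAlternatingMap.alternatizeUncurryFinCLM ℝ E ℝ) _ _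
  rw [hs]
  rfl

variable [IsManifold I ∞ M]

theorem formInChart_formPullback {k : ℕ} (Ω : DiffForm I' M' k) {f : M → M'}
    (hf : ContMDiff I I' ∞ f) (x : M) {y : E} (hy : y ∈ (extChartAt I x).target) :
    formInChart I (formPullback I I' f Ω) x y =
      formPullback 𝓘(ℝ, E) I' (f ∘ (extChartAt I x).symm) Ω y := by
  rw [formInChart_eq_formPullback]
  exact (formPullback_comp_apply Ω (hf.mdifferentiableAt (by simp))
    ((contMDiffAt_extChartAt_symm hy).mdifferentiableAt (by simp))).symm

variable [I'.Boundaryless] [IsManifold I' ∞ M']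

/-- The exterior derivative commutes with pull-back by smooth maps of manifolds. -/
theorem formPullback_mextDeriv {k : ℕ} {Ω : DiffForm I' M' k} (hΩ : IsSmoothForm I' Ω)
    {f : M → M'} (hf : ContMDiff I I' ∞ f) :
    formPullback I I' f (mextDeriv I' Ω) = mextDeriv I (formPullback I I' f Ω) := by
  ext1 x
  have hx := mem_extChartAt_target (I := I) x
  have hsymm := contMDiffAt_extChartAt_symm hx
  have he : formInChart I (formPullback I I' f Ω) x =ᶠ[𝓝 (extChartAt I x x)]
      formPullback 𝓘(ℝ, E) I' (f ∘ (extChartAt I x).symm) Ω := by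
    filter_upwards [(isOpen_extChartAt_target x).mem_nhds hx] with y hy
    exact formInChart_formPullback Ω hf x hy
  rw [mextDeriv, I.range_eq_univ, extDerivWithin_univ, he.extDeriv_eq,
    ← formPullback_mextDeriv_vectorSpace hΩ (hf.contMDiffAt.comp _ hsymm)]
  -- Near `x`, `f` is a map out of the model space, already treated, composed with the chart at `x`.
  have hg : f =ᶠ[𝓝 x] (f ∘ (extChartAt I x).symm) ∘ extChartAt I x := by
    filter_upwards [extChartAt_source_mem_nhds (I := I) x] with y hy
    simp only [Function.comp_apply, (extChartAt I x).left_inv hy]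
  have hc := formPullback_comp_apply (mextDeriv I' Ω) (x := x)
    (((hf.contMDiffAt.comp _ hsymm)).mdifferentiableAt (by simp))
    (mdifferentiableAt_extChartAt (I := I) (mem_chart_source H x))
  refine Eq.trans ?_ hc
  simp only [formPullback, hg.mfderiv_eq]
  rw [hg.self_of_nhds]

theorem contDiffAt_formPullback {V : Type*} [NormedAddCommGroup V] [NormedSpace ℝ V]
    {Ω : DiffForm I' M' 1} (hΩ : IsSmoothForm I' Ω) {f : V → M'} {v : V}
    (hf : ContMDiffAt 𝓘(ℝ, V) I' ∞ f v) :
    ContDiffAt ℝ ∞ (F := V [⋀^Fin 1]→L[ℝ] ℝ) (formPullback 𝓘(ℝ, V) I' f Ω) v := by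
  refine ContDiffAt.congr_of_eventuallyEq ?_ (formPullback_eventuallyEq Ω hf)
  have hc := contDiffAt_extChartAt_comp hf
  exact ((hΩ.contDiffAt _ (mem_extChartAt_target (f v))).comp v hc).compContinuousLinearMap_one
    (hc.fderiv_right (by simp))

/-- The pull-back of a smooth `1`-form is smooth. -/
theorem IsSmoothForm.formPullback {Ω : DiffForm I' M' 1} (hΩ : IsSmoothForm I' Ω)
    {f : M → M'} (hf : ContMDiff I I' ∞ f) : IsSmoothForm I (formPullback I I' f Ω) := by
  intro x
  refine ContDiffOn.congr (fun y hy ↦ ContDiffAt.contDiffWithinAt ?_)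
    fun y hy ↦ formInChart_formPullback Ω hf x hy
  exact contDiffAt_formPullback hΩ (hf.contMDiffAt.comp _ (contMDiffAt_extChartAt_symm hy))

end Pullback

/-- Constant vector fields commute, so the invariant formula for `d` has no bracket term. -/
theorem extDeriv_one_apply {V : Type*} [NormedAddCommGroup V] [NormedSpace ℝ V]
    {A : V → V [⋀^Fin 1]→L[ℝ] ℝ} {v : V} (hA : DifferentiableAt ℝ A v) (a b : V) :
    extDeriv A v ![a, b] =
      fderiv ℝ (fun w ↦ A w fun _ ↦ b) v a - fderiv ℝ (fun w ↦ A w fun _ ↦ a) v b := by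
  have h0 : (0 : Fin 2).removeNth ![a, b] = fun _ ↦ b := by
    ext i; fin_cases i; rfl
  have h1 : (1 : Fin 2).removeNth ![a, b] = fun _ ↦ a := by
    ext i; fin_cases i; rfl
  rw [extDeriv_apply hA, Fin.sum_univ_two, h0, h1]
  simp [sub_eq_add_neg]

theorem contDiff_ofSubsingleton {V W : Type*} [NormedAddCommGroup V] [NormedSpace ℝ V]
    [NormedAddCommGroup W] [NormedSpace ℝ W] {n : WithTop ℕ∞} {θ : W → V →L[ℝ] ℝ}
    (hθ : ContDiff ℝ n θ) :
    ContDiff ℝ n fun w ↦ ContinuousAlternatingMap.ofSubsingleton ℝ V ℝ (0 : Fin 1) (θ w) :=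
  (ContinuousAlternatingMap.ofSubsingletonLIE (𝕜 := ℝ) (E := V) (F := ℝ)
    (0 : Fin 1)).contDiff.comp hθ

/-! ### Canonical coordinates on the cotangent bundle and the Liouville form. -/

section Cotangent

variable {E : Type*} [NormedAddCommGroup E] [NormedSpace ℝ E]
  {M : Type*} [TopologicalSpace M] [ChartedSpace E M] [IsManifold 𝓘(ℝ, E) ∞ M]

theorem contMDiff_cotangentProj :
    ContMDiff (cotangentModel E) 𝓘(ℝ, E) ∞ (cotangentProj E M) :=
  Bundle.contMDiff_proj _

theorem mem_cotangent_extChartAt_source {z z' : CotangentBundle E M} :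
    z' ∈ (extChartAt (cotangentModel E) z).source ↔ z'.1 ∈ (chartAt E z.1).source := by
  rw [extChartAt_source]
  simp only [FiberBundle.chartedSpace_chartAt, mfld_simps]
  exact ⟨fun h ↦ h.1.1, fun h ↦ ⟨⟨h, trivial⟩, h⟩⟩

/-- The target line bundle is trivial, so only the trivialization of the tangent bundle enters. -/
theorem inCoordinates_cotangent_apply (q₀ q b₀ b : M) (p : E →L[ℝ] ℝ) (v : E) :
    ContinuousLinearMap.inCoordinates E (TangentSpace 𝓘(ℝ, E)) ℝ (Bundle.Trivial M ℝ) q₀ q b₀ b p v =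
      p ((trivializationAt E (TangentSpace 𝓘(ℝ, E)) q₀).symmL ℝ q v) := by
  simp [ContinuousLinearMap.inCoordinates]
  rfl

/-- The preferred charts of the cotangent bundle are the canonical coordinates. -/
theorem cotangent_extChartAt_apply {z z' : CotangentBundle E M}
    (h : z'.1 ∈ (chartAt E z.1).source) :
    extChartAt (cotangentModel E) z z' = (extChartAt 𝓘(ℝ, E) z.1 z'.1,
      (z'.2 : E →L[ℝ] ℝ).comp (mfderivWithin 𝓘(ℝ, E) 𝓘(ℝ, E) (extChartAt 𝓘(ℝ, E) z.1).symm
        (Set.range 𝓘(ℝ, E)) (extChartAt 𝓘(ℝ, E) z.1 z'.1))) := by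
  rw [← TangentBundle.symmL_trivializationAt h]
  have hc : extChartAt (cotangentModel E) z z' =
    chartAt (ModelProd E (E →L[ℝ] ℝ)) z z' := rfl
  rw [hc, hom_chart]
  refine Prod.ext rfl ?_
  ext v
  exact inCoordinates_cotangent_apply _ _ _ _ _ v

theorem cotangentProj_extChartAt_symm {z : CotangentBundle E M} {w : E × (E →L[ℝ] ℝ)}
    (hw : w ∈ (extChartAt (cotangentModel E) z).target) :
    w.1 ∈ (extChartAt 𝓘(ℝ, E) z.1).target ∧
      cotangentProj E M ((extChartAt (cotangentModel E) z).symm w) =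
        (extChartAt 𝓘(ℝ, E) z.1).symm w.1 := by
  have hs := (extChartAt (cotangentModel E) z).map_target hw
  rw [mem_cotangent_extChartAt_source] at hs
  have hr := (extChartAt (cotangentModel E) z).right_inv hw
  rw [cotangent_extChartAt_apply hs] at hr
  have h1 := congrArg Prod.fst hr
  simp only at h1
  rw [← extChartAt_source 𝓘(ℝ, E)] at hs
  rw [← h1, (extChartAt 𝓘(ℝ, E) z.1).left_inv hs]
  exact ⟨(extChartAt 𝓘(ℝ, E) z.1).map_source hs, rfl⟩

/-- In canonical coordinates, the Liouville form is `p dq`. -/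
theorem formInChart_liouville (z : CotangentBundle E M) {w : E × (E →L[ℝ] ℝ)}
    (hw : w ∈ (extChartAt (cotangentModel E) z).target) :
    formInChart (cotangentModel E) (oneForm (cotangentModel E) (liouville E M)) z w =
      ContinuousAlternatingMap.ofSubsingleton ℝ (E × (E →L[ℝ] ℝ)) ℝ (0 : Fin 1)
        (w.2.comp (ContinuousLinearMap.fst ℝ E (E →L[ℝ] ℝ))) := by
  obtain ⟨h1, h2⟩ := cotangentProj_extChartAt_symm hw
  have hs := (extChartAt (cotangentModel E) z).map_target hw
  rw [mem_cotangent_extChartAt_source] at hs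
  have hr := (extChartAt (cotangentModel E) z).right_inv hw
  rw [cotangent_extChartAt_apply hs] at hr
  have hr2 := congrArg Prod.snd hr
  have hr1 := congrArg Prod.fst hr
  simp only at hr1 hr2
  have he : cotangentProj E M ∘ (extChartAt (cotangentModel E) z).symm =ᶠ[𝓝 w]
      (extChartAt 𝓘(ℝ, E) z.1).symm ∘ Prod.fst := by
    filter_upwards [(isOpen_extChartAt_target z).mem_nhds hw] with w' hw'
    exact (cotangentProj_extChartAt_symm hw').2
  -- Chain rule for `he`: in canonical coordinates the projection is the first factor.
  have hd : (mfderiv (cotangentModel E) 𝓘(ℝ, E) (cotangentProj E M)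
      ((extChartAt (cotangentModel E) z).symm w)).comp
        (mfderiv 𝓘(ℝ, E × (E →L[ℝ] ℝ)) (cotangentModel E)
          (extChartAt (cotangentModel E) z).symm w) =
      (mfderiv 𝓘(ℝ, E) 𝓘(ℝ, E) (extChartAt 𝓘(ℝ, E) z.1).symm w.1).comp
        (ContinuousLinearMap.fst ℝ E (E →L[ℝ] ℝ)) := by
    rw [← mfderiv_comp w (contMDiff_cotangentProj.mdifferentiableAt (by simp))
      ((contMDiffAt_extChartAt_symm hw).mdifferentiableAt (by simp)), he.mfderiv_eq,
      mfderiv_comp w ((contMDiffAt_extChartAt_symm h1).mdifferentiableAt (by simp))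
        differentiableAt_fst.mdifferentiableAt, mfderiv_eq_fderiv (f := Prod.fst), fderiv_fst]
    rfl
  rw [formInChart_eq_formPullback, formPullback_oneForm]
  -- `hr2` now says that the fibre coordinate `w.2` is the covector composed with the derivative of
  -- the inverse chart, exactly the composite left by `hd`.
  rw [modelWithCornersSelf_coe, Set.range_id, mfderivWithin_univ, hr1] at hr2
  rw [← hr2]
  have hl : (liouville E M ((extChartAt (cotangentModel E) z).symm w)).comp
      (mfderiv 𝓘(ℝ, E × (E →L[ℝ] ℝ)) (cotangentModel E)
        (extChartAt (cotangentModel E) z).symm w) =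
      (((extChartAt (cotangentModel E) z).symm w).2 : E →L[ℝ] ℝ).comp
        ((mfderiv 𝓘(ℝ, E) 𝓘(ℝ, E) (extChartAt 𝓘(ℝ, E) z.1).symm w.1).comp
          (ContinuousLinearMap.fst ℝ E (E →L[ℝ] ℝ))) :=
    congrArg (fun L : E × (E →L[ℝ] ℝ) →L[ℝ] E ↦
      (((extChartAt (cotangentModel E) z).symm w).2 : E →L[ℝ] ℝ).comp L) hd
  exact congrArg (ContinuousAlternatingMap.ofSubsingleton ℝ (E × (E →L[ℝ] ℝ)) ℝ (0 : Fin 1)) hl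

theorem isSmoothForm_liouville :
    IsSmoothForm (cotangentModel E) (oneForm (cotangentModel E) (liouville E M)) := by
  intro z
  refine ContDiffOn.congr (ContDiff.contDiffOn ?_) fun w hw ↦ formInChart_liouville z hw
  exact contDiff_ofSubsingleton (contDiff_snd.clm_comp contDiff_const)

/-- The coordinate formula `d(p dq)` applies directly to tangent vectors at `z`, because the
preferred chart at `z` has the identity as its derivative there. -/
theorem mextDeriv_liouville_apply (z : CotangentBundle E M) (v w : E × (E →L[ℝ] ℝ)) :
    mextDeriv (cotangentModel E) (oneForm (cotangentModel E) (liouville E M)) z ![v, w] =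
      v.2 w.1 - w.2 v.1 := by
  have hz := mem_extChartAt_target (I := cotangentModel E) z
  have he : formInChart (cotangentModel E) (oneForm (cotangentModel E) (liouville E M)) z
      =ᶠ[𝓝 (extChartAt (cotangentModel E) z z)] fun w ↦
        ContinuousAlternatingMap.ofSubsingleton ℝ (E × (E →L[ℝ] ℝ)) ℝ (0 : Fin 1)
          (w.2.comp (ContinuousLinearMap.fst ℝ E (E →L[ℝ] ℝ))) := by
    filter_upwards [(isOpen_extChartAt_target z).mem_nhds hz] with w hw
    exact formInChart_liouville z hw
  have hd : mextDeriv (cotangentModel E) (oneForm (cotangentModel E) (liouville E M)) z ![v, w] =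
      extDeriv (formInChart (cotangentModel E) (oneForm (cotangentModel E) (liouville E M)) z)
        (extChartAt (cotangentModel E) z z) ![v, w] := by
    rw [mextDeriv, ModelWithCorners.range_eq_univ, extDerivWithin_univ, mfderiv_extChartAt_self]
    rfl
  rw [hd, extDeriv_one_apply ((isSmoothForm_liouville.contDiffAt z hz).differentiableAt (by simp))]
  have h (a b : E × (E →L[ℝ] ℝ)) : fderiv ℝ (fun w ↦
      formInChart (cotangentModel E) (oneForm (cotangentModel E) (liouville E M)) z w fun _ ↦ b)
        (extChartAt (cotangentModel E) z z) a = a.2 b.1 := by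
    have he' : (fun w ↦ formInChart (cotangentModel E)
        (oneForm (cotangentModel E) (liouville E M)) z w fun _ ↦ b)
          =ᶠ[𝓝 (extChartAt (cotangentModel E) z z)]
        ((ContinuousLinearMap.apply ℝ ℝ b.1).comp (ContinuousLinearMap.snd ℝ E (E →L[ℝ] ℝ))) := by
      filter_upwards [he] with w hw
      rw [hw]
      rfl
    rw [he'.fderiv_eq, ContinuousLinearMap.fderiv]
    rfl
  rw [h, h]

theorem mfderiv_cotangentProj_apply (z : CotangentBundle E M) (v : E × (E →L[ℝ] ℝ)) :
    mfderiv (cotangentModel E) 𝓘(ℝ, E) (cotangentProj E M) z v = v.1 := by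
  have hz := mem_extChartAt_target (I := cotangentModel E) z
  have he : writtenInExtChartAt (cotangentModel E) 𝓘(ℝ, E) z (cotangentProj E M)
      =ᶠ[𝓝 (extChartAt (cotangentModel E) z z)] Prod.fst := by
    filter_upwards [(isOpen_extChartAt_target z).mem_nhds hz] with w hw
    obtain ⟨h1, h2⟩ := cotangentProj_extChartAt_symm hw
    simp only [writtenInExtChartAt, Function.comp_apply, h2]
    exact (extChartAt 𝓘(ℝ, E) z.1).right_inv h1
  have hm : mfderiv (cotangentModel E) 𝓘(ℝ, E) (cotangentProj E M) z =
      ContinuousLinearMap.fst ℝ E (E →L[ℝ] ℝ) := by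
    rw [(contMDiff_cotangentProj.mdifferentiableAt (by simp)).mfderiv,
      ModelWithCorners.range_eq_univ, fderivWithin_univ, he.fderiv_eq, fderiv_fst]
  rw [hm]
  rfl

end Cotangent

/-! ### Cartan's formula for an invariant 1-form, without flows. -/

section InvariantPotential

variable {F : Type*} [NormedAddCommGroup F] [NormedSpace ℝ F]
  {K : Type*} [TopologicalSpace K] {J : ModelWithCorners ℝ F K} [J.Boundaryless]
  {G : Type*} [TopologicalSpace G] [ChartedSpace K G] [IsManifold J ∞ G]
  {E : Type*} [NormedAddCommGroup E] [NormedSpace ℝ E]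
  {H : Type*} [TopologicalSpace H] {I : ModelWithCorners ℝ E H}
  {N : Type*} [TopologicalSpace N] [ChartedSpace H N] [IsManifold I ∞ N]

theorem mfderiv_eq_fderiv_comp_extChartAt_symm {μ : N → ℝ} {z : N}
    (hμ : DifferentiableAt ℝ (μ ∘ (extChartAt I z).symm) (extChartAt I z z)) (v : E) :
    mfderiv I 𝓘(ℝ, ℝ) μ z v = fderiv ℝ (μ ∘ (extChartAt I z).symm) (extChartAt I z z) v := by
  have he : μ =ᶠ[𝓝 z] (μ ∘ (extChartAt I z).symm) ∘ extChartAt I z := by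
    filter_upwards [extChartAt_source_mem_nhds (I := I) z] with y hy
    simp only [Function.comp_apply, (extChartAt I z).left_inv hy]
  rw [he.mfderiv_eq, mfderiv_comp z hμ.mdifferentiableAt
    (mdifferentiableAt_extChartAt (mem_chart_source H z)), mfderiv_extChartAt_self,
    mfderiv_eq_fderiv]
  rfl

variable [I.Boundaryless]

theorem mfderiv_extChartAt_symm_self (x : N) :
    mfderiv 𝓘(ℝ, E) I (extChartAt I x).symm (extChartAt I x x) = ContinuousLinearMap.id ℝ E := by
  have h := mfderivWithin_range_extChartAt_symm (I := I) (x := x)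
  rwa [I.range_eq_univ, mfderivWithin_univ] at h

variable {a : G → N → N}

theorem contMDiffAt_act_charts (ha : ContMDiff (J.prod I) I ∞ (fun x : G × N ↦ a x.1 x.2))
    {g₀ : G} {z : N} {s : F} {y : E} (hs : s ∈ (extChartAt J g₀).target)
    (hy : y ∈ (extChartAt I z).target) :
    ContMDiffAt 𝓘(ℝ, F × E) I ∞
      (fun w : F × E ↦ a ((extChartAt J g₀).symm w.1) ((extChartAt I z).symm w.2)) (s, y) := by
  have h1 : ContMDiffAt 𝓘(ℝ, F × E) J ∞ ((extChartAt J g₀).symm ∘ Prod.fst) (s, y) :=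
    ContMDiffAt.comp (I' := 𝓘(ℝ, F)) (s, y) (contMDiffAt_extChartAt_symm hs)
      contDiff_fst.contMDiff.contMDiffAt
  have h2 : ContMDiffAt 𝓘(ℝ, F × E) I ∞ ((extChartAt I z).symm ∘ Prod.snd) (s, y) :=
    ContMDiffAt.comp (I' := 𝓘(ℝ, E)) (s, y) (contMDiffAt_extChartAt_symm hy)
      contDiff_snd.contMDiff.contMDiffAt
  exact ha.contMDiffAt.comp (s, y) (h1.prodMk h2)

theorem mfderiv_act_charts_fst (ha : ContMDiff (J.prod I) I ∞ (fun x : G × N ↦ a x.1 x.2))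
    {g₀ : G} {z : N} {s : F} {y : E} (hs : s ∈ (extChartAt J g₀).target)
    (hy : y ∈ (extChartAt I z).target) (ξ : F) :
    (mfderiv 𝓘(ℝ, F × E) I
      (fun w : F × E ↦ a ((extChartAt J g₀).symm w.1) ((extChartAt I z).symm w.2)) (s, y)
        (ξ, (0 : E)) : E) =
    mfderiv J I (fun g ↦ a g ((extChartAt I z).symm y)) ((extChartAt J g₀).symm s)
      (mfderiv 𝓘(ℝ, F) J (extChartAt J g₀).symm s ξ) := by
  have h1 := mfderiv_comp_apply (I := 𝓘(ℝ, F)) (I' := 𝓘(ℝ, F × E)) (I'' := I) s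
    (f := fun s' : F ↦ (s', y))
    (g := fun w : F × E ↦ a ((extChartAt J g₀).symm w.1) ((extChartAt I z).symm w.2))
    ((contMDiffAt_act_charts ha hs hy).mdifferentiableAt (by simp))
    (hasFDerivAt_prodMk_left s y).differentiableAt.mdifferentiableAt ξ
  have hg : ContMDiff J I ∞ (fun g ↦ a g ((extChartAt I z).symm y)) :=
    ha.comp (contMDiff_id.prodMk contMDiff_const)
  have h2 := mfderiv_comp_apply (I := 𝓘(ℝ, F)) (I' := J) (I'' := I) s
    (f := (extChartAt J g₀).symm) (g := fun g ↦ a g ((extChartAt I z).symm y))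
    (hg.mdifferentiableAt (by simp))
    ((contMDiffAt_extChartAt_symm hs).mdifferentiableAt (by simp)) ξ
  rw [mfderiv_eq_fderiv (f := fun s' : F ↦ (s', y)), (hasFDerivAt_prodMk_left s y).fderiv] at h1
  exact h1.symm.trans h2

theorem mfderiv_act_charts_snd (ha : ContMDiff (J.prod I) I ∞ (fun x : G × N ↦ a x.1 x.2))
    {g₀ : G} {z : N} {s : F} {y : E} (hs : s ∈ (extChartAt J g₀).target)
    (hy : y ∈ (extChartAt I z).target) (v : E) :
    (mfderiv 𝓘(ℝ, F × E) I
      (fun w : F × E ↦ a ((extChartAt J g₀).symm w.1) ((extChartAt I z).symm w.2)) (s, y)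
        ((0 : F), v) : E) =
    mfderiv I I (a ((extChartAt J g₀).symm s)) ((extChartAt I z).symm y)
      (mfderiv 𝓘(ℝ, E) I (extChartAt I z).symm y v) := by
  have h1 := mfderiv_comp_apply (I := 𝓘(ℝ, E)) (I' := 𝓘(ℝ, F × E)) (I'' := I) y
    (f := fun y' : E ↦ (s, y'))
    (g := fun w : F × E ↦ a ((extChartAt J g₀).symm w.1) ((extChartAt I z).symm w.2))
    ((contMDiffAt_act_charts ha hs hy).mdifferentiableAt (by simp))
    (hasFDerivAt_prodMk_right s y).differentiableAt.mdifferentiableAt v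
  have hg : ContMDiff I I ∞ (a ((extChartAt J g₀).symm s)) :=
    ha.comp (contMDiff_const.prodMk contMDiff_id)
  have h2 := mfderiv_comp_apply (I := 𝓘(ℝ, E)) (I' := I) (I'' := I) y
    (f := (extChartAt I z).symm) (g := a ((extChartAt J g₀).symm s))
    (hg.mdifferentiableAt (by simp))
    ((contMDiffAt_extChartAt_symm hy).mdifferentiableAt (by simp)) v
  rw [mfderiv_eq_fderiv (f := fun y' : E ↦ (s, y')), (hasFDerivAt_prodMk_right s y).fderiv] at h1
  exact h1.symm.trans h2

/-- Writes `θ(X^#)` in a chart as a coefficient of the pull-back of `θ` under the action map, along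
the slice of the group identity. Smoothness and the differential of `θ(X^#)` are both read off from
this pull-back. -/
theorem apply_generator_comp_symm_eventuallyEq [Group G] (h_one : ∀ z, a 1 z = z)
    (ha : ContMDiff (J.prod I) I ∞ (fun x : G × N ↦ a x.1 x.2))
    (θ : (z : N) → TangentSpace I z →L[ℝ] ℝ) (X : GroupLieAlgebra J G) (z : N) :
    (fun y ↦ θ y (generator J I a y X)) ∘ (extChartAt I z).symm =ᶠ[𝓝 (extChartAt I z z)]
      fun y ↦ (formPullback 𝓘(ℝ, F × E) I
        (fun w : F × E ↦ a ((extChartAt J (1 : G)).symm w.1) ((extChartAt I z).symm w.2))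
          (oneForm I θ) (extChartAt J (1 : G) 1, y) : (F × E) [⋀^Fin 1]→L[ℝ] ℝ)
            fun _ ↦ ((X : F), (0 : E)) := by
  -- Base points such as `a 1 y` and `y` agree only propositionally, while their tangent spaces all
  -- unfold to `E`; such transport lemmas bridge the gap.
  have hθ_congr : ∀ {y y' : N}, y = y' → ∀ u : E, (θ y : E →L[ℝ] ℝ) u = (θ y' : E →L[ℝ] ℝ) u := by
    rintro y _ rfl u; rfl
  have hgen : ∀ (g : G) (y : N), g = 1 →
      (θ (a g y) : E →L[ℝ] ℝ) (mfderiv J I (fun g ↦ a g y) g X : E) =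
        θ y (generator J I a y X) := by
    rintro _ y rfl
    exact hθ_congr (h_one y) _
  filter_upwards [(isOpen_extChartAt_target z).mem_nhds (mem_extChartAt_target z)] with y hy
  have h1 := mfderiv_act_charts_fst ha (mem_extChartAt_target (1 : G)) hy X
  rw [mfderiv_extChartAt_symm_self] at h1
  exact ((congrArg (θ (a ((extChartAt J (1 : G)).symm (extChartAt J (1 : G) 1))
    ((extChartAt I z).symm y)) : E →L[ℝ] ℝ) h1).trans (hgen _ _ (extChartAt_to_inv (1 : G)))).symm

theorem contMDiff_apply_generator [Group G] (h_one : ∀ z, a 1 z = z)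
    (ha : ContMDiff (J.prod I) I ∞ (fun x : G × N ↦ a x.1 x.2))
    {θ : (z : N) → TangentSpace I z →L[ℝ] ℝ} (hθ : IsSmoothForm I (oneForm I θ))
    (X : GroupLieAlgebra J G) :
    ContMDiff I 𝓘(ℝ, ℝ) ∞ (fun y ↦ θ y (generator J I a y X)) := by
  intro z
  have hη := contDiffAt_formPullback hθ (contMDiffAt_act_charts ha
    (mem_extChartAt_target (1 : G)) (mem_extChartAt_target z))
  have hηX := ((ContinuousAlternatingMap.apply ℝ (F × E) ℝ
    (fun _ : Fin 1 ↦ ((X : F), (0 : E)))).contDiff.contDiffAt.comp _ hη).comp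
      (extChartAt I z z) (contDiff_prodMk_right (extChartAt J (1 : G) 1)).contDiffAt
  have hμ := hηX.congr_of_eventuallyEq (apply_generator_comp_symm_eventuallyEq h_one ha θ X z)
  refine (hμ.contMDiffAt.comp z contMDiffAt_extChartAt).congr_of_eventuallyEq ?_
  filter_upwards [extChartAt_source_mem_nhds (I := I) z] with y hy
  exact (congrArg (fun y ↦ θ y (generator J I a y X)) ((extChartAt I z).left_inv hy)).symm

/-- If a smooth action preserves the `1`-form `θ`, then `θ (X^#)` is, up to sign, a Hamiltonian
function of `X^#` for `dθ`. -/
theorem mextDeriv_generator_apply [Group G] (h_one : ∀ z, a 1 z = z)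
    (ha : ContMDiff (J.prod I) I ∞ (fun x : G × N ↦ a x.1 x.2))
    {θ : (z : N) → TangentSpace I z →L[ℝ] ℝ} (hθ : IsSmoothForm I (oneForm I θ))
    (hinv : ∀ g, formPullback I I (a g) (oneForm I θ) = oneForm I θ)
    (X : GroupLieAlgebra J G) (z : N) (v : TangentSpace I z) :
    mextDeriv I (oneForm I θ) z ![generator J I a z X, v] =
      -(mfderiv I 𝓘(ℝ, ℝ) (fun y ↦ θ y (generator J I a y X)) z v : ℝ) := by
  set φ := extChartAt J (1 : G)
  set ψ := extChartAt I z
  set s₀ : F := φ 1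
  set y₀ : E := ψ z
  have hs₀ : s₀ ∈ φ.target := mem_extChartAt_target (1 : G)
  have hy₀ : y₀ ∈ ψ.target := mem_extChartAt_target z
  have e1 : φ.symm s₀ = 1 := extChartAt_to_inv (1 : G)
  have e2 : ψ.symm y₀ = z := extChartAt_to_inv z
  have hdφ : mfderiv 𝓘(ℝ, F) J φ.symm s₀ = ContinuousLinearMap.id ℝ F :=
    mfderiv_extChartAt_symm_self (1 : G)
  have hdψ : mfderiv 𝓘(ℝ, E) I ψ.symm y₀ = ContinuousLinearMap.id ℝ E :=
    mfderiv_extChartAt_symm_self z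
  -- The action map in charts replaces the flow. On `F × E` the vectors `X` and `v` extend to the
  -- constant fields `(X, 0)` and `(0, v)`, and `dθ` is evaluated by pulling back to `η`.
  let f : F × E → N := fun w ↦ a (φ.symm w.1) (ψ.symm w.2)
  have hf : ContMDiffAt 𝓘(ℝ, F × E) I ∞ f (s₀, y₀) := contMDiffAt_act_charts ha hs₀ hy₀
  let η : F × E → (F × E) [⋀^Fin 1]→L[ℝ] ℝ := formPullback 𝓘(ℝ, F × E) I f (oneForm I θ)
  have hη : DifferentiableAt ℝ η (s₀, y₀) :=
    (contDiffAt_formPullback hθ hf).differentiableAt (by simp)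
  have hpull := congrArg
    (fun A : (F × E) [⋀^Fin 2]→L[ℝ] ℝ ↦ A ![((X : F), (0 : E)), ((0 : F), (v : E))])
    (formPullback_mextDeriv_vectorSpace hθ hf)
  have hηd (u : F × E) : DifferentiableAt ℝ (fun w ↦ η w fun _ ↦ u) (s₀, y₀) :=
    hη.continuousAlternatingMap_apply_const _
  let μ : N → ℝ := fun y ↦ θ y (generator J I a y X)
  -- along the group direction, `η (0, v)` is constant
  have hfst : fderiv ℝ (fun w ↦ η w fun _ ↦ ((0 : F), (v : E))) (s₀, y₀) ((X : F), (0 : E)) = 0 := by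
    have hc := HasFDerivAt.comp (f := fun s : F ↦ (s, y₀)) s₀
      (hηd ((0 : F), (v : E))).hasFDerivAt (hasFDerivAt_prodMk_left s₀ y₀)
    have he : (fun w ↦ η w fun _ ↦ ((0 : F), (v : E))) ∘ (fun s : F ↦ (s, y₀)) =ᶠ[𝓝 s₀]
        fun _ ↦ (θ (ψ.symm y₀) : E →L[ℝ] ℝ) (mfderiv 𝓘(ℝ, E) I ψ.symm y₀ v) := by
      filter_upwards [(isOpen_extChartAt_target (1 : G)).mem_nhds hs₀] with s hs
      have h1 := mfderiv_act_charts_snd ha hs hy₀ v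
      have h2 := congrArg (fun A : E [⋀^Fin 1]→L[ℝ] ℝ ↦ A fun _ ↦
        (mfderiv 𝓘(ℝ, E) I ψ.symm y₀ v : E)) (congrFun (hinv (φ.symm s)) (ψ.symm y₀))
      exact (congrArg (θ (f (s, y₀)) : E →L[ℝ] ℝ) h1).trans h2
    have h0 := (hc.congr_of_eventuallyEq he.symm).unique (hasFDerivAt_const _ s₀)
    exact congrArg (fun L : F →L[ℝ] ℝ ↦ L (X : F)) h0
  -- Along the manifold direction, `η (X, 0)` is `θ(X^#)` read in the chart.
  have hsnd : fderiv ℝ (fun w ↦ η w fun _ ↦ ((X : F), (0 : E))) (s₀, y₀) ((0 : F), (v : E)) =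
      mfderiv I 𝓘(ℝ, ℝ) μ z v := by
    have hc := HasFDerivAt.comp (f := fun y : E ↦ (s₀, y)) y₀
      (hηd ((X : F), (0 : E))).hasFDerivAt (hasFDerivAt_prodMk_right s₀ y₀)
    have h0 := hc.congr_of_eventuallyEq
      (apply_generator_comp_symm_eventuallyEq h_one ha θ X z)
    exact ((mfderiv_eq_fderiv_comp_extChartAt_symm h0.differentiableAt v).trans
      (congrArg (fun L : E →L[ℝ] ℝ ↦ L (v : E)) h0.fderiv)).symm
  have hX : (mfderiv 𝓘(ℝ, F × E) I f (s₀, y₀) ((X : F), (0 : E)) : E) = generator J I a z X := by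
    have h1 := mfderiv_act_charts_fst ha hs₀ hy₀ X
    rw [hdφ] at h1
    have h2 : ∀ (g : G) (y : N), g = 1 → y = z →
      (mfderiv J I (fun g ↦ a g y) g X : E) = generator J I a z X := by
      rintro _ _ rfl rfl; rfl
    exact h1.trans (h2 _ _ e1 e2)
  have hv : (mfderiv 𝓘(ℝ, F × E) I f (s₀, y₀) ((0 : F), (v : E)) : E) = v := by
    have h1 := mfderiv_act_charts_snd ha hs₀ hy₀ v
    rw [hdψ] at h1
    have h2 : ∀ (g : G) (y : N), g = 1 → (mfderiv I I (a g) y v : E) = v := by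
      rintro _ y rfl
      have : a 1 = id := funext h_one
      rw [this, mfderiv_id]
      rfl
    exact h1.trans (h2 _ _ e1)
  have hΩ_congr : ∀ {y y' : N}, y = y' → ∀ u u' : E,
      (mextDeriv I (oneForm I θ) y : E [⋀^Fin 2]→L[ℝ] ℝ) ![u, u'] =
        (mextDeriv I (oneForm I θ) y' : E [⋀^Fin 2]→L[ℝ] ℝ) ![u, u'] := by
    rintro y _ rfl u u'; rfl
  have hf₀ : f (s₀, y₀) = z := by simp only [f, e1, e2, h_one]
  have hR := extDeriv_one_apply hη ((X : F), (0 : E)) ((0 : F), (v : E))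
  rw [hfst, hsnd] at hR
  refine Eq.trans ?_ (hpull.trans (hR.trans (zero_sub _)))
  refine ((hΩ_congr hf₀ _ _).symm).trans ?_
  rw [← hX]
  have hvec : (![(mfderiv 𝓘(ℝ, F × E) I f (s₀, y₀) ((X : F), (0 : E)) : E), (v : E)] : Fin 2 → E) =
      fun i ↦ (mfderiv 𝓘(ℝ, F × E) I f (s₀, y₀)
        ((![((X : F), (0 : E)), ((0 : F), (v : E))] : Fin 2 → F × E) i) : E) := by
    ext i
    fin_cases i
    · rfl
    · exact hv.symm
  exact congrArg (mextDeriv I (oneForm I θ) (f (s₀, y₀)) : E [⋀^Fin 2]→L[ℝ] ℝ) hvec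

end InvariantPotential

/-! ### The cotangent lift is a smooth left action. -/

section Lift

variable {E : Type*} [NormedAddCommGroup E] [NormedSpace ℝ E]
  {M : Type*} [TopologicalSpace M] [ChartedSpace E M]
  {G : Type*} [Group G] [MulAction G M]

theorem mfderiv_one_smul (q : M) :
    mfderiv 𝓘(ℝ, E) 𝓘(ℝ, E) (fun q : M ↦ (1 : G) • q) q = ContinuousLinearMap.id ℝ E := by
  have : (fun q : M ↦ (1 : G) • q) = id := funext fun q ↦ one_smul G q
  rw [this, mfderiv_id]
  rfl

theorem mfderiv_smul_comp (hG : ∀ g : G, ContMDiff 𝓘(ℝ, E) 𝓘(ℝ, E) ∞ (fun q : M ↦ g • q))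
    (g h : G) (q : M) :
    (mfderiv 𝓘(ℝ, E) 𝓘(ℝ, E) (fun q : M ↦ g • q) (h • q)).comp
        (mfderiv 𝓘(ℝ, E) 𝓘(ℝ, E) (fun q : M ↦ h • q) q) =
      (mfderiv 𝓘(ℝ, E) 𝓘(ℝ, E) (fun q : M ↦ (g * h) • q) q : E →L[ℝ] E) := by
  have hc : (fun q : M ↦ (g * h) • q) = (fun q : M ↦ g • q) ∘ (fun q : M ↦ h • q) :=
    funext fun q ↦ mul_smul g h q
  rw [hc, mfderiv_comp (I' := 𝓘(ℝ, E)) q ((hG g).mdifferentiableAt (by simp))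
    ((hG h).mdifferentiableAt (by simp))]

theorem mfderiv_inv_smul_comp (hG : ∀ g : G, ContMDiff 𝓘(ℝ, E) 𝓘(ℝ, E) ∞ (fun q : M ↦ g • q))
    (g : G) (q : M) :
    (mfderiv 𝓘(ℝ, E) 𝓘(ℝ, E) (fun q : M ↦ g⁻¹ • q) (g • q)).comp
        (mfderiv 𝓘(ℝ, E) 𝓘(ℝ, E) (fun q : M ↦ g • q) q) = ContinuousLinearMap.id ℝ E := by
  have h := mfderiv_smul_comp hG g⁻¹ g q
  rw [inv_mul_cancel] at h
  exact h.trans (mfderiv_one_smul q)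

theorem mfderiv_smul_comp_inv (hG : ∀ g : G, ContMDiff 𝓘(ℝ, E) 𝓘(ℝ, E) ∞ (fun q : M ↦ g • q))
    (g : G) (q : M) :
    (mfderiv 𝓘(ℝ, E) 𝓘(ℝ, E) (fun q : M ↦ g • q) q : E →L[ℝ] E).comp
        (mfderiv 𝓘(ℝ, E) 𝓘(ℝ, E) (fun q : M ↦ g⁻¹ • q) (g • q) : E →L[ℝ] E) =
      ContinuousLinearMap.id ℝ E := by
  have h := mfderiv_inv_smul_comp hG g⁻¹ (g • q)
  rw [inv_inv, inv_smul_smul] at h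
  exact h

/-- `ContinuousLinearMap.inverse` has a default value at non-invertible maps; identifying it with
the derivative of `g⁻¹` excludes that case and gives an expression that is visibly smooth in `g` and
`q`. -/
theorem inverse_mfderiv_smul (hG : ∀ g : G, ContMDiff 𝓘(ℝ, E) 𝓘(ℝ, E) ∞ (fun q : M ↦ g • q))
    (g : G) (q : M) :
    (mfderiv 𝓘(ℝ, E) 𝓘(ℝ, E) (fun q : M ↦ g • q) q).inverse =
      (mfderiv 𝓘(ℝ, E) 𝓘(ℝ, E) (fun q : M ↦ g⁻¹ • q) (g • q) : E →L[ℝ] E) :=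
  ContinuousLinearMap.inverse_eq
    (f := (mfderiv 𝓘(ℝ, E) 𝓘(ℝ, E) (fun q : M ↦ g • q) q : E →L[ℝ] E))
    (mfderiv_smul_comp_inv hG g q) (mfderiv_inv_smul_comp hG g q)

theorem inverse_mfderiv_smul_comp
    (hG : ∀ g : G, ContMDiff 𝓘(ℝ, E) 𝓘(ℝ, E) ∞ (fun q : M ↦ g • q)) (g : G) (q : M) :
    ((mfderiv 𝓘(ℝ, E) 𝓘(ℝ, E) (fun q : M ↦ g • q) q).inverse : E →L[ℝ] E).comp
      (mfderiv 𝓘(ℝ, E) 𝓘(ℝ, E) (fun q : M ↦ g • q) q : E →L[ℝ] E) =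
      ContinuousLinearMap.id ℝ E := by
  rw [inverse_mfderiv_smul hG g q]
  exact mfderiv_inv_smul_comp hG g q

theorem inverse_mfderiv_mul_smul
    (hG : ∀ g : G, ContMDiff 𝓘(ℝ, E) 𝓘(ℝ, E) ∞ (fun q : M ↦ g • q)) (g h : G) (q : M) :
    ((mfderiv 𝓘(ℝ, E) 𝓘(ℝ, E) (fun q : M ↦ (g * h) • q) q).inverse : E →L[ℝ] E) =
      ((mfderiv 𝓘(ℝ, E) 𝓘(ℝ, E) (fun q : M ↦ h • q) q).inverse : E →L[ℝ] E).comp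
        ((mfderiv 𝓘(ℝ, E) 𝓘(ℝ, E) (fun q : M ↦ g • q) (h • q)).inverse : E →L[ℝ] E) := by
  have hi : (mfderiv 𝓘(ℝ, E) 𝓘(ℝ, E) (fun q : M ↦ h • q) q : E →L[ℝ] E).IsInvertible :=
    .of_inverse (mfderiv_smul_comp_inv hG h q) (mfderiv_inv_smul_comp hG h q)
  have hc := mfderiv_smul_comp hG g h q
  exact (congrArg (fun L : E →L[ℝ] E ↦ L.inverse) hc.symm).trans hi.inverse_comp_of_right

theorem cotangentBundle_mk_congr {q q' : M} (hq : q = q') {p p' : E →L[ℝ] ℝ} (hp : p = p') :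
    (⟨q, p⟩ : CotangentBundle E M) = ⟨q', p'⟩ := by
  subst hq hp; rfl

theorem cotangentLift_one (z : CotangentBundle E M) : cotangentLift (1 : G) z = z := by
  refine cotangentBundle_mk_congr (E := E) (M := M) (one_smul G z.1) ?_
  rw [mfderiv_one_smul]
  exact congrArg (z.2 : E →L[ℝ] ℝ).comp (ContinuousLinearMap.inverse_id (R := ℝ) (M := E))

theorem cotangentLift_mul (hG : ∀ g : G, ContMDiff 𝓘(ℝ, E) 𝓘(ℝ, E) ∞ (fun q : M ↦ g • q))
    (g h : G) (z : CotangentBundle E M) :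
    cotangentLift (g * h) z = cotangentLift g (cotangentLift h z) :=
  cotangentBundle_mk_congr (E := E) (M := M) (mul_smul g h z.1)
    (congrArg (z.2 : E →L[ℝ] ℝ).comp (inverse_mfderiv_mul_smul hG g h z.1))

theorem contMDiff_cotangentLift [IsManifold 𝓘(ℝ, E) ∞ M]
    {F : Type*} [NormedAddCommGroup F] [NormedSpace ℝ F]
    [TopologicalSpace G] [ChartedSpace F G] [LieGroup 𝓘(ℝ, F) ∞ G]
    [ContMDiffSMul 𝓘(ℝ, F) 𝓘(ℝ, E) ∞ G M] :
    ContMDiff (𝓘(ℝ, F).prod (cotangentModel E)) (cotangentModel E) ∞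
      (fun x : G × CotangentBundle E M ↦ cotangentLift x.1 x.2) := by
  have hG : ∀ g : G, ContMDiff 𝓘(ℝ, E) 𝓘(ℝ, E) ∞ (fun q : M ↦ g • q) :=
    fun g ↦ ContMDiffSMul.contMDiff_const_smul (I := 𝓘(ℝ, F)) g
  intro x₀
  have hb : ContMDiff (𝓘(ℝ, F).prod (cotangentModel E)) 𝓘(ℝ, E) ∞
      (fun x : G × CotangentBundle E M ↦ x.2.1) :=
    contMDiff_cotangentProj.comp contMDiff_snd
  have hgb : ContMDiff (𝓘(ℝ, F).prod (cotangentModel E)) 𝓘(ℝ, E) ∞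
      (fun x : G × CotangentBundle E M ↦ x.1 • x.2.1) :=
    ContMDiff.smul (I := 𝓘(ℝ, F)) contMDiff_fst hb
  refine (contMDiffAt_hom_bundle _).2 ⟨hgb x₀, ?_⟩
  have hs : ContMDiff (𝓘(ℝ, F).prod (cotangentModel E)) (cotangentModel E) ∞
      (fun x : G × CotangentBundle E M ↦ x.2) := contMDiff_snd
  have hp := ((contMDiffAt_hom_bundle _).1 (hs x₀)).2
  have hinv : ContMDiff ((𝓘(ℝ, F).prod (cotangentModel E)).prod 𝓘(ℝ, E)) 𝓘(ℝ, E) ∞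
      (Function.uncurry fun (x : G × CotangentBundle E M) (q : M) ↦ x.1⁻¹ • q) :=
    ContMDiff.smul (I := 𝓘(ℝ, F))
      ((contMDiff_inv 𝓘(ℝ, F) ∞).comp (contMDiff_fst.comp contMDiff_fst)) contMDiff_snd
  -- The derivative of `g⁻¹` at `g • q` depends smoothly on `(g, q)`, being a derivative with
  -- parameters; the fibre part of the lift is the covector composed with it.
  have hA := ContMDiffAt.mfderiv (I := 𝓘(ℝ, E)) (I' := 𝓘(ℝ, E)) (m := ∞) (n := ∞) (x₀ := x₀)
    (fun (x : G × CotangentBundle E M) (q : M) ↦ x.1⁻¹ • q) (fun x ↦ x.1 • x.2.1)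
    hinv.contMDiffAt hgb.contMDiffAt le_rfl
  simp only [inv_smul_smul] at hA
  refine (hp.clm_comp hA).congr_of_eventuallyEq ?_
  -- On this base set the trivialization at `x₀.2.1` cancels its inverse between the two factors of
  -- the composition.
  filter_upwards [hb.continuous.continuousAt.eventually_mem
    ((trivializationAt E (TangentSpace 𝓘(ℝ, E)) x₀.2.1).open_baseSet.mem_nhds
      (FiberBundle.mem_baseSet_trivializationAt' x₀.2.1))] with x hx
  ext v
  let u : E := (trivializationAt E (TangentSpace 𝓘(ℝ, E)) (x₀.1 • x₀.2.1)).symmL ℝ (x.1 • x.2.1) v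
  have h1 := congrArg (fun L : E →L[ℝ] E ↦ (x.2.2 : E →L[ℝ] ℝ) (L u))
    (inverse_mfderiv_smul hG x.1 x.2.1)
  have h2 := congrArg (x.2.2 : E →L[ℝ] ℝ)
    ((trivializationAt E (TangentSpace 𝓘(ℝ, E)) x₀.2.1).symmL_continuousLinearMapAt (R := ℝ) hx
      (mfderiv 𝓘(ℝ, E) 𝓘(ℝ, E) (fun q : M ↦ x.1⁻¹ • q) (x.1 • x.2.1) u : E))
  exact (inCoordinates_cotangent_apply (E := E) (M := M) _ _ _ _ _ v).trans <|
    (h1.trans h2.symm).trans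
      (inCoordinates_cotangent_apply (E := E) (M := M) _ _ _ _ _ _).symm

end Lift

/-! ### The primitive of the twisted form, and nondegeneracy. -/

section Potential

variable {E : Type*} [NormedAddCommGroup E] [NormedSpace ℝ E]
  {M : Type*} [TopologicalSpace M] [ChartedSpace E M] [IsManifold 𝓘(ℝ, E) ∞ M]

/-- The primitive `λ_can - π^* α` of the twisted form. -/
noncomputable def twistedPotential (α : (q : M) → TangentSpace 𝓘(ℝ, E) q →L[ℝ] ℝ)
    (z : CotangentBundle E M) : TangentSpace (cotangentModel E) z →L[ℝ] ℝ :=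
  liouville E M z - (α z.1).comp (mfderiv (cotangentModel E) 𝓘(ℝ, E) (cotangentProj E M) z)

theorem twistedPotential_apply (α : (q : M) → TangentSpace 𝓘(ℝ, E) q →L[ℝ] ℝ)
    (z : CotangentBundle E M) (v : E × (E →L[ℝ] ℝ)) :
    twistedPotential α z v = (z.2 : E →L[ℝ] ℝ) v.1 - (α z.1 : E →L[ℝ] ℝ) v.1 := by
  rw [← mfderiv_cotangentProj_apply z v]
  rfl

theorem oneForm_twistedPotential (α : (q : M) → TangentSpace 𝓘(ℝ, E) q →L[ℝ] ℝ) :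
    oneForm (cotangentModel E) (twistedPotential α) =
      oneForm (cotangentModel E) (liouville E M) -
        formPullback (cotangentModel E) 𝓘(ℝ, E) (cotangentProj E M) (oneForm 𝓘(ℝ, E) α) :=
  rfl

/-- A smooth section of the cotangent bundle is the pull-back of the Liouville form by itself, hence
a smooth form. -/
theorem isSmoothForm_oneForm {α : (q : M) → TangentSpace 𝓘(ℝ, E) q →L[ℝ] ℝ}
    (hα : ContMDiff 𝓘(ℝ, E) (cotangentModel E) ∞
      (fun q : M ↦ (⟨q, α q⟩ : CotangentBundle E M))) :
    IsSmoothForm 𝓘(ℝ, E) (oneForm 𝓘(ℝ, E) α) := by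
  have h : formPullback 𝓘(ℝ, E) (cotangentModel E) (fun q : M ↦ (⟨q, α q⟩ : CotangentBundle E M))
      (oneForm (cotangentModel E) (liouville E M)) = oneForm 𝓘(ℝ, E) α := by
    rw [formPullback_oneForm]
    congr 1
    ext q v
    have hd := mfderiv_comp_apply (I := 𝓘(ℝ, E)) (I' := cotangentModel E) (I'' := 𝓘(ℝ, E)) q
      (f := fun q : M ↦ (⟨q, α q⟩ : CotangentBundle E M)) (g := cotangentProj E M)
      (contMDiff_cotangentProj.mdifferentiableAt (by simp)) (hα.mdifferentiableAt (by simp)) v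
    have hid : cotangentProj E M ∘ (fun q : M ↦ (⟨q, α q⟩ : CotangentBundle E M)) = id := rfl
    rw [hid, mfderiv_id] at hd
    exact congrArg (α q : E →L[ℝ] ℝ) hd.symm
  rw [← h]
  exact isSmoothForm_liouville.formPullback hα

theorem isSmoothForm_twistedPotential {α : (q : M) → TangentSpace 𝓘(ℝ, E) q →L[ℝ] ℝ}
    (hα : IsSmoothForm 𝓘(ℝ, E) (oneForm 𝓘(ℝ, E) α)) :
    IsSmoothForm (cotangentModel E) (oneForm (cotangentModel E) (twistedPotential α)) := by
  rw [oneForm_twistedPotential]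
  exact isSmoothForm_liouville.sub (hα.formPullback contMDiff_cotangentProj)

theorem twistedForm_eq_mextDeriv {α : (q : M) → TangentSpace 𝓘(ℝ, E) q →L[ℝ] ℝ}
    (hα : IsSmoothForm 𝓘(ℝ, E) (oneForm 𝓘(ℝ, E) α)) :
    twistedForm α = mextDeriv (cotangentModel E)
      (oneForm (cotangentModel E) (twistedPotential α)) := by
  rw [oneForm_twistedPotential, mextDeriv_sub isSmoothForm_liouville
    (hα.formPullback contMDiff_cotangentProj), ← formPullback_mextDeriv hα contMDiff_cotangentProj]
  rfl

theorem twistedForm_apply (α : (q : M) → TangentSpace 𝓘(ℝ, E) q →L[ℝ] ℝ)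
    (z : CotangentBundle E M) (v w : E × (E →L[ℝ] ℝ)) :
    twistedForm α z ![v, w] = v.2 w.1 - w.2 v.1 -
      (mextDeriv 𝓘(ℝ, E) (oneForm 𝓘(ℝ, E) α) z.1 : E [⋀^Fin 2]→L[ℝ] ℝ) ![v.1, w.1] := by
  rw [← mextDeriv_liouville_apply z v w]
  have h : (formPullback (cotangentModel E) 𝓘(ℝ, E) (cotangentProj E M)
      (mextDeriv 𝓘(ℝ, E) (oneForm 𝓘(ℝ, E) α)) z : (E × (E →L[ℝ] ℝ)) [⋀^Fin 2]→L[ℝ] ℝ) ![v, w] =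
      (mextDeriv 𝓘(ℝ, E) (oneForm 𝓘(ℝ, E) α) z.1 : E [⋀^Fin 2]→L[ℝ] ℝ) ![v.1, w.1] := by
    refine congrArg (mextDeriv 𝓘(ℝ, E) (oneForm 𝓘(ℝ, E) α) z.1 : E [⋀^Fin 2]→L[ℝ] ℝ) ?_
    ext i
    fin_cases i
    · exact mfderiv_cotangentProj_apply z v
    · exact mfderiv_cotangentProj_apply z w
  rw [← h]
  rfl

theorem isSymplecticForm_twistedForm {α : (q : M) → TangentSpace 𝓘(ℝ, E) q →L[ℝ] ℝ}
    (hα : IsSmoothForm 𝓘(ℝ, E) (oneForm 𝓘(ℝ, E) α)) :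
    IsSymplecticForm (cotangentModel E) (twistedForm α) where
  smooth := by
    rw [twistedForm_eq_mextDeriv hα]
    exact isSmoothForm_mextDeriv (isSmoothForm_twistedPotential hα)
  closed := by
    rw [twistedForm_eq_mextDeriv hα]
    exact mextDeriv_mextDeriv (isSmoothForm_twistedPotential hα)
  nondegenerate := by
    intro z v hv
    have hv' (w : E × (E →L[ℝ] ℝ)) := (twistedForm_apply α z v w).symm.trans (hv w)
    let v' : E × (E →L[ℝ] ℝ) := v
    have h1 : v'.1 = 0 := by
      -- Pairing with vertical vectors `(0, p)` kills the twist and leaves `p v'.1 = 0` for every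
      -- `p`; functionals separate points.
      refine SeparatingDual.eq_zero_of_forall_dual_eq_zero (R := ℝ) fun p ↦ ?_
      have h := hv' (0, p)
      have h0 : (mextDeriv 𝓘(ℝ, E) (oneForm 𝓘(ℝ, E) α) z.1 : E [⋀^Fin 2]→L[ℝ] ℝ)
          ![v'.1, (0 : E)] = 0 := ContinuousAlternatingMap.map_coord_zero _ 1 rfl
      have h' : v'.2 (0 : E) - p v'.1 - (mextDeriv 𝓘(ℝ, E) (oneForm 𝓘(ℝ, E) α) z.1 :
        E [⋀^Fin 2]→L[ℝ] ℝ) ![v'.1, (0 : E)] = 0 := h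
      rw [h0, map_zero] at h'
      linarith
    have h2 : v'.2 = 0 := by
      -- With the base component zero the twist vanishes again, and pairing with `(u, 0)` isolates
      -- `v'.2 u`.
      ext u
      have h' : v'.2 u - (0 : E →L[ℝ] ℝ) v'.1 - (mextDeriv 𝓘(ℝ, E) (oneForm 𝓘(ℝ, E) α) z.1 :
        E [⋀^Fin 2]→L[ℝ] ℝ) ![v'.1, u] = 0 := hv' (u, 0)
      have h0 : (mextDeriv 𝓘(ℝ, E) (oneForm 𝓘(ℝ, E) α) z.1 : E [⋀^Fin 2]→L[ℝ] ℝ)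
          ![v'.1, u] = 0 := ContinuousAlternatingMap.map_coord_zero _ 0 h1
      rw [h0] at h'
      simpa using h'
    exact Prod.ext h1 h2

end Potential

/-! ### Invariance of the potential and equivariance of the moment map. -/

section Action

variable {E : Type*} [NormedAddCommGroup E] [NormedSpace ℝ E]
  {M : Type*} [TopologicalSpace M] [ChartedSpace E M]
  {G : Type*} [Group G] [MulAction G M]
  {α : (q : M) → TangentSpace 𝓘(ℝ, E) q →L[ℝ] ℝ}

/-- Differentiate `h g q = g (g⁻¹ h g) q` in `h` at the identity. -/
theorem generator_smul {F : Type*} [NormedAddCommGroup F] [NormedSpace ℝ F]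
    [TopologicalSpace G] [ChartedSpace F G] [LieGroup 𝓘(ℝ, F) ∞ G]
    [ContMDiffSMul 𝓘(ℝ, F) 𝓘(ℝ, E) ∞ G M] (g : G) (q : M) (X : GroupLieAlgebra 𝓘(ℝ, F) G) :
    (generator 𝓘(ℝ, F) 𝓘(ℝ, E) (fun (g : G) (q : M) ↦ g • q) (g • q) X : E) =
      (mfderiv 𝓘(ℝ, E) 𝓘(ℝ, E) (fun q : M ↦ g • q) q : E →L[ℝ] E)
        (generator 𝓘(ℝ, F) 𝓘(ℝ, E) (fun (g : G) (q : M) ↦ g • q) q (Ad 𝓘(ℝ, F) g⁻¹ X)) := by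
  have hG : ContMDiff 𝓘(ℝ, E) 𝓘(ℝ, E) ∞ (fun q : M ↦ g • q) :=
    ContMDiffSMul.contMDiff_const_smul (I := 𝓘(ℝ, F)) g
  -- The double inverse is kept so that the map is literally the one defining `Ad` at `g⁻¹`.
  have hconj : ContMDiff 𝓘(ℝ, F) 𝓘(ℝ, F) ∞ (fun h : G ↦ g⁻¹ * h * g⁻¹⁻¹) :=
    (contMDiff_mul_right (I := 𝓘(ℝ, F))).comp contMDiff_mul_left
  have horb : ContMDiff 𝓘(ℝ, F) 𝓘(ℝ, E) ∞ (fun h : G ↦ h • q) :=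
    ContMDiff.smul (I := 𝓘(ℝ, F)) contMDiff_id contMDiff_const
  have hfun : (fun h : G ↦ h • g • q) =
      (fun q : M ↦ g • q) ∘ (fun h : G ↦ h • q) ∘ (fun h : G ↦ g⁻¹ * h * g⁻¹⁻¹) := by
    ext h
    simp only [Function.comp_apply, ← mul_smul]
    congr 1
    group
  have h1 := mfderiv_comp_apply (I := 𝓘(ℝ, F)) (I' := 𝓘(ℝ, E)) (I'' := 𝓘(ℝ, E)) (1 : G)
    (f := (fun h : G ↦ h • q) ∘ (fun h : G ↦ g⁻¹ * h * g⁻¹⁻¹)) (g := fun q : M ↦ g • q)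
    (hG.mdifferentiableAt (by simp)) ((horb.comp hconj).mdifferentiableAt (by simp)) X
  have h2 := mfderiv_comp_apply (I := 𝓘(ℝ, F)) (I' := 𝓘(ℝ, F)) (I'' := 𝓘(ℝ, E)) (1 : G)
    (f := fun h : G ↦ g⁻¹ * h * g⁻¹⁻¹) (g := fun h : G ↦ h • q)
    (horb.mdifferentiableAt (by simp)) (hconj.mdifferentiableAt (by simp)) X
  rw [← hfun] at h1
  have h3 : ∀ (k : G), k = 1 → ∀ Y : F, (mfderiv 𝓘(ℝ, F) 𝓘(ℝ, E) (fun h : G ↦ h • q) k Y : E) =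
      generator 𝓘(ℝ, F) 𝓘(ℝ, E) (fun (g : G) (q : M) ↦ g • q) q Y := by
    rintro _ rfl Y; rfl
  have h4 : ∀ q' : M, q' = q → ∀ u : E, (mfderiv 𝓘(ℝ, E) 𝓘(ℝ, E) (fun q : M ↦ g • q) q' u : E) =
      (mfderiv 𝓘(ℝ, E) 𝓘(ℝ, E) (fun q : M ↦ g • q) q : E →L[ℝ] E) u := by
    rintro _ rfl u; rfl
  refine h1.trans ((h4 ((g⁻¹ * 1 * g⁻¹⁻¹) • q) (by simp) _).trans ?_)
  exact congrArg (mfderiv 𝓘(ℝ, E) 𝓘(ℝ, E) (fun q : M ↦ g • q) q : E →L[ℝ] E)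
    (h2.trans (h3 (g⁻¹ * 1 * g⁻¹⁻¹) (by simp) _))

theorem cotangentMoment_cotangentLift {F : Type*} [NormedAddCommGroup F] [NormedSpace ℝ F]
    [TopologicalSpace G] [ChartedSpace F G] [LieGroup 𝓘(ℝ, F) ∞ G]
    [ContMDiffSMul 𝓘(ℝ, F) 𝓘(ℝ, E) ∞ G M]
    (hinv : ∀ (g : G) (q : M),
      (α (g • q)).comp (mfderiv 𝓘(ℝ, E) 𝓘(ℝ, E) (fun x : M ↦ g • x) q) = α q)
    (g : G) (z : CotangentBundle E M) (X : GroupLieAlgebra 𝓘(ℝ, F) G) :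
    cotangentMoment α (cotangentLift g z) X = cotangentMoment α z (Ad 𝓘(ℝ, F) g⁻¹ X) := by
  have hG : ∀ g : G, ContMDiff 𝓘(ℝ, E) 𝓘(ℝ, E) ∞ (fun q : M ↦ g • q) :=
    fun g ↦ ContMDiffSMul.contMDiff_const_smul (I := 𝓘(ℝ, F)) g
  let u : E := generator 𝓘(ℝ, F) 𝓘(ℝ, E) (fun (g : G) (q : M) ↦ g • q) z.1 (Ad 𝓘(ℝ, F) g⁻¹ X)
  have h4 : (mfderiv 𝓘(ℝ, E) 𝓘(ℝ, E) (fun q : M ↦ g • q) z.1).inverse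
      (mfderiv 𝓘(ℝ, E) 𝓘(ℝ, E) (fun q : M ↦ g • q) z.1 u) = u :=
    congrArg (fun L : E →L[ℝ] E ↦ L u) (inverse_mfderiv_smul_comp hG g z.1)
  have h5 : (α (g • z.1) : E →L[ℝ] ℝ) (mfderiv 𝓘(ℝ, E) 𝓘(ℝ, E) (fun q : M ↦ g • q) z.1 u) =
      (α z.1 : E →L[ℝ] ℝ) u := congrArg (fun L : E →L[ℝ] ℝ ↦ L u) (hinv g z.1)
  have h6 := congrArg (fun w : E ↦ ((cotangentLift g z).2 : E →L[ℝ] ℝ) w -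
    (α (g • z.1) : E →L[ℝ] ℝ) w) (generator_smul g z.1 X)
  refine h6.trans ?_
  exact congrArg₂ (fun a b : ℝ ↦ a - b) (congrArg (z.2 : E →L[ℝ] ℝ) h4) h5

variable [IsManifold 𝓘(ℝ, E) ∞ M]

/-- Since `π` intertwines the lift with the action on `M`, `θ` at the image point is evaluated on
`dg u` with `u = dπ v`. In the Liouville term `dg` cancels the inverse built into the lift; in the
other term it is absorbed by the invariance of `α`. -/
theorem formPullback_cotangentLift_twistedPotential
    (hG : ∀ g : G, ContMDiff 𝓘(ℝ, E) 𝓘(ℝ, E) ∞ (fun q : M ↦ g • q))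
    (hinv : ∀ (g : G) (q : M),
      (α (g • q)).comp (mfderiv 𝓘(ℝ, E) 𝓘(ℝ, E) (fun x : M ↦ g • x) q) = α q) (g : G)
    (hlift : ContMDiff (cotangentModel E) (cotangentModel E) ∞
      (cotangentLift g : CotangentBundle E M → CotangentBundle E M)) :
    formPullback (cotangentModel E) (cotangentModel E) (cotangentLift g)
      (oneForm (cotangentModel E) (twistedPotential α)) =
        oneForm (cotangentModel E) (twistedPotential α) := by
  rw [formPullback_oneForm]
  congr 1
  ext z v
  have h1 := mfderiv_comp_apply (I := cotangentModel E) (I' := cotangentModel E) (I'' := 𝓘(ℝ, E)) z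
    (f := cotangentLift g) (g := cotangentProj E M)
    (contMDiff_cotangentProj.mdifferentiableAt (by simp)) (hlift.mdifferentiableAt (by simp)) v
  have h2 := mfderiv_comp_apply (I := cotangentModel E) (I' := 𝓘(ℝ, E)) (I'' := 𝓘(ℝ, E)) z
    (f := cotangentProj E M) (g := fun q : M ↦ g • q)
    ((hG g).mdifferentiableAt (by simp)) (contMDiff_cotangentProj.mdifferentiableAt (by simp)) v
  have h3 := h1.symm.trans h2
  let u : E := mfderiv (cotangentModel E) 𝓘(ℝ, E) (cotangentProj E M) z v
  have h4 : (mfderiv 𝓘(ℝ, E) 𝓘(ℝ, E) (fun q : M ↦ g • q) z.1).inverse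
      (mfderiv 𝓘(ℝ, E) 𝓘(ℝ, E) (fun q : M ↦ g • q) z.1 u) = u :=
    congrArg (fun L : E →L[ℝ] E ↦ L u) (inverse_mfderiv_smul_comp hG g z.1)
  have h5 : (α (g • z.1) : E →L[ℝ] ℝ) (mfderiv 𝓘(ℝ, E) 𝓘(ℝ, E) (fun q : M ↦ g • q) z.1 u) =
      (α z.1 : E →L[ℝ] ℝ) u := congrArg (fun L : E →L[ℝ] ℝ ↦ L u) (hinv g z.1)
  have h6 := congrArg (fun w : E ↦ ((cotangentLift g z).2 : E →L[ℝ] ℝ) w -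
    (α (g • z.1) : E →L[ℝ] ℝ) w) h3
  refine h6.trans ?_
  exact congrArg₂ (fun a b : ℝ ↦ a - b) (congrArg (z.2 : E →L[ℝ] ℝ) h4) h5

variable {F : Type*} [NormedAddCommGroup F] [NormedSpace ℝ F]
  [TopologicalSpace G] [ChartedSpace F G] [LieGroup 𝓘(ℝ, F) ∞ G]
  [ContMDiffSMul 𝓘(ℝ, F) 𝓘(ℝ, E) ∞ G M]

variable (G F) in
-- `θ` sees only the projection of a vector to `M`, and the orbit map upstairs projects to the orbit
-- map of the base point.
theorem twistedPotential_generator (α : (q : M) → TangentSpace 𝓘(ℝ, E) q →L[ℝ] ℝ)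
    (z : CotangentBundle E M) (X : GroupLieAlgebra 𝓘(ℝ, F) G) :
    twistedPotential α z
      (generator 𝓘(ℝ, F) (cotangentModel E)
        (cotangentLift : G → CotangentBundle E M → CotangentBundle E M) z X) =
      cotangentMoment (F := F) (G := G) α z X := by
  have hlift : ContMDiff 𝓘(ℝ, F) (cotangentModel E) ∞ (fun g : G ↦ cotangentLift g z) :=
    (contMDiff_cotangentLift (F := F)).comp (contMDiff_id.prodMk contMDiff_const)
  have h1 := mfderiv_comp_apply (I := 𝓘(ℝ, F)) (I' := cotangentModel E) (I'' := 𝓘(ℝ, E)) (1 : G)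
    (f := fun g : G ↦ cotangentLift g z) (g := cotangentProj E M)
    (contMDiff_cotangentProj.mdifferentiableAt (by simp)) (hlift.mdifferentiableAt (by simp)) X
  have h2 := h1.trans (mfderiv_cotangentProj_apply _ _)
  refine (twistedPotential_apply α z _).trans ?_
  exact (congrArg (fun w : E ↦ (z.2 : E →L[ℝ] ℝ) w - (α z.1 : E →L[ℝ] ℝ) w) h2).symm

end Action

end TwistedCotangent

theorem mainTheorem12
    {E : Type*} [NormedAddCommGroup E] [NormedSpace ℝ E] [FiniteDimensional ℝ E]
    {M : Type*} [TopologicalSpace M] [ChartedSpace E M] [IsManifold 𝓘(ℝ, E) ∞ M]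
    {F : Type*} [NormedAddCommGroup F] [NormedSpace ℝ F] [FiniteDimensional ℝ F]
    {G : Type*} [TopologicalSpace G] [ChartedSpace F G] [Group G] [LieGroup 𝓘(ℝ, F) ∞ G]
    [MulAction G M] [ContMDiffSMul 𝓘(ℝ, F) 𝓘(ℝ, E) ∞ G M]
    (α : (q : M) → TangentSpace 𝓘(ℝ, E) q →L[ℝ] ℝ)
    (hα : ContMDiff 𝓘(ℝ, E) (TwistedCotangent.cotangentModel E) ∞
      (fun q : M ↦ (⟨q, α q⟩ : TwistedCotangent.CotangentBundle E M)))
    (hinv : ∀ (g : G) (q : M),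
      (α (g • q)).comp (mfderiv 𝓘(ℝ, E) 𝓘(ℝ, E) (fun x : M ↦ g • x) q) = α q) :
    TwistedCotangent.IsHamiltonianAction 𝓘(ℝ, F) (TwistedCotangent.cotangentModel E)
      (TwistedCotangent.twistedForm α)
      (TwistedCotangent.cotangentLift : G → TwistedCotangent.CotangentBundle E M →
        TwistedCotangent.CotangentBundle E M)
      (TwistedCotangent.cotangentMoment (F := F) (G := G) α) := by
  have hα' := TwistedCotangent.isSmoothForm_oneForm hα
  have hθ := TwistedCotangent.isSmoothForm_twistedPotential hα'
  have hact := TwistedCotangent.contMDiff_cotangentLift (E := E) (M := M) (G := G) (F := F)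
  have hG : ∀ g : G, ContMDiff 𝓘(ℝ, E) 𝓘(ℝ, E) ∞ (fun q : M ↦ g • q) :=
    fun g ↦ ContMDiffSMul.contMDiff_const_smul (I := 𝓘(ℝ, F)) g
  have hlift : ∀ g : G, ContMDiff (TwistedCotangent.cotangentModel E)
      (TwistedCotangent.cotangentModel E) ∞ (TwistedCotangent.cotangentLift g :
        TwistedCotangent.CotangentBundle E M → TwistedCotangent.CotangentBundle E M) :=
    fun g ↦ hact.comp (contMDiff_const.prodMk contMDiff_id)
  -- Identifying the moment map with `θ(X^#)` reduces its smoothness and the Hamiltonian equation to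
  -- the general statements on invariant 1-forms.
  have hμ (X : GroupLieAlgebra 𝓘(ℝ, F) G) :=
    funext fun z ↦ TwistedCotangent.twistedPotential_generator G F α z X
  have hθinv : ∀ g : G, _ := fun g ↦
    TwistedCotangent.formPullback_cotangentLift_twistedPotential hG hinv g (hlift g)
  exact
    { isSymplectic := TwistedCotangent.isSymplecticForm_twistedForm hα'
      one_act := TwistedCotangent.cotangentLift_one
      mul_act := TwistedCotangent.cotangentLift_mul hG
      smooth_act := hact
      pullback_act := fun g ↦ by
        rw [TwistedCotangent.twistedForm_eq_mextDeriv hα',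
          TwistedCotangent.formPullback_mextDeriv hθ (hlift g), hθinv g]
      smooth_moment := fun X ↦ by
        rw [← hμ X]
        exact TwistedCotangent.contMDiff_apply_generator TwistedCotangent.cotangentLift_one hact
          hθ X
      hamiltonian := fun X z v ↦ by
        rw [TwistedCotangent.twistedForm_eq_mextDeriv hα']
        exact (TwistedCotangent.mextDeriv_generator_apply TwistedCotangent.cotangentLift_one hact
          hθ hθinv X z v).trans (congrArg (fun m : TwistedCotangent.CotangentBundle E M → ℝ ↦
            (-(mfderiv (TwistedCotangent.cotangentModel E) 𝓘(ℝ, ℝ) m z v) : ℝ)) (hμ X))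
      equivariant := TwistedCotangent.cotangentMoment_cotangentLift hinv }
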